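/- For an integer $N\ge 2$ write points of $\mathbb{R}^{2N}$ as $X=(X_1,\dots,X_N)$ with $X_n\in\mathbb{R}^2$, and let $\nabla_n$ denote the gradient with respect to $X_n$. Let $\dot H^1(\mathbb{R}^{2N})$ be the homogeneous Sobolev space, that is, the completion of $C_c^\infty(\mathbb{R}^{2N})$ (complex-valued functions) with respect to the quadratic form $\sum_{n=1}^N\int_{\mathbb{R}^{2N}}|\nabla_n u|^2\,dX$, realized as a space of functions. A function $u$ on $\mathbb{R}^{2N}$ is antisymmetric if for every permutation $\sigma$ of $\{1,\dots,N\}$ one has $u(X_1,\dots,X_N)=(\operatorname{sgn}\sigma)\,u(X_{\sigma(1)},\dots,X_{\sigma(N)})$ for a.e. $X\in\mathbb{R}^{2N}$. Define the fermionic many-particle Hardy constant (in dimension $d=2$, with $s=1$) by $$ \kappa_N^{(2)} := \inf_{\substack{0\neq u\in\dot H^1(\mathbb{R}^{2N})\\ u\ \text{antisymmetric}}} \frac{\sum_{n=1}^N \int_{\mathbb{R}^{2N}} |\nabla_n u(X)|^2\,dX}{\sum_{1\leq n<m\leq N} \int_{\mathbb{R}^{2N}} \frac{|u(X)|^2}{|X_n-X_m|^2}\,dX}\,.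 $$ Then $$ \limsup_{N\to\infty}\ (\ln N)\,\kappa_N^{(2)} \le 4 . $$ -/

import Mathlib

open MeasureTheory Filter Topology
open scoped ENNReal ContDiff

noncomputable section

namespace ManyParticleHardy

/-- Configurations `X = (X_1, …, X_N)` of `N` particles in `ℝ^d`. The one-particle space carries the
Euclidean norm, and `volume` on this product is Lebesgue measure on `ℝ^{dN}`. -/
abbrev Config (d N : ℕ) : Type := Fin N → EuclideanSpace ℝ (Fin d)

/-- The coordinate direction in `ℝ^{dN}` of the `j`-th coordinate of the `n`-th particle. -/
def dir {d N : ℕ} (n : Fin N) (j : Fin d) : Config d N :=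
  Pi.single n (EuclideanSpace.single j (1 : ℝ))

/-- The classical partial derivative `∂φ / ∂X_{n,j}`. -/
def partialDeriv {d N : ℕ} (φ : Config d N → ℂ) (n : Fin N) (j : Fin d) (X : Config d N) : ℂ :=
  fderiv ℝ φ X (dir n j)

/-- `u` belongs to the homogeneous Sobolev space `Ḣ¹(ℝ^{dN})` and `g n j` is its weak derivative
with respect to `X_{n,j}`.

`Ḣ¹(ℝ^{dN})` is the completion of `C_c^∞(ℝ^{dN})` for `∑ₙ ∫ |∇ₙ φ|²`. When `d N ≥ 3` it is a space of
functions: every sequence in `C_c^∞` that is Cauchy for this form converges in `L¹_loc`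
(by the Sobolev inequality), and it is identified with its limit `u`, whose weak gradient `g` is the
`L²`-limit of the gradients. -/
def IsHomSobolevWithGradient {d N : ℕ} (u : Config d N → ℂ)
    (g : Fin N → Fin d → Config d N → ℂ) : Prop :=
  LocallyIntegrable u volume ∧
  (∀ n j, MemLp (g n j) 2 volume) ∧
  ∃ φ : ℕ → Config d N → ℂ,
    (∀ k, ContDiff ℝ ∞ (φ k) ∧ HasCompactSupport (φ k)) ∧
    (∀ K : Set (Config d N), IsCompact K →
      Tendsto (fun k => ∫⁻ X in K, ‖φ k X - u X‖ₑ) atTop (𝓝 0)) ∧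
    (∀ n j, Tendsto (fun k => ∫⁻ X, ‖partialDeriv (φ k) n j X - g n j X‖ₑ ^ 2) atTop (𝓝 0))

/-- Antisymmetry: `u(X_1, …, X_N) = (sgn σ) u(X_{σ(1)}, …, X_{σ(N)})` for all `σ` and a.e. `X`. -/
def IsAntisymmetric {d N : ℕ} (u : Config d N → ℂ) : Prop :=
  ∀ σ : Equiv.Perm (Fin N), ∀ᵐ X : Config d N,
    u X = ((Equiv.Perm.sign σ : ℤ) : ℂ) * u (fun n => X (σ n))

/-- The kinetic energy `∑ₙ ∫ |∇ₙ u|² dX`, in terms of the gradient `g` of `u`. -/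
def kineticEnergy {d N : ℕ} (g : Fin N → Fin d → Config d N → ℂ) : ℝ≥0∞ :=
  ∑ n, ∫⁻ X, ∑ j, ‖g n j X‖ₑ ^ 2

/-- The interaction energy `∑_{n<m} ∫ |u(X)|² / |X_n - X_m|² dX`. -/
def interactionEnergy {d N : ℕ} (u : Config d N → ℂ) : ℝ≥0∞ :=
  ∑ n : Fin N, ∑ m ∈ Finset.Ioi n, ∫⁻ X : Config d N, ‖u X‖ₑ ^ 2 / ‖X n - X m‖ₑ ^ 2

/-- The fermionic many-particle Hardy constant `κ_N^{(d)}` (with `s = 1`), the infimum of the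
quotient of the two energies over all antisymmetric `0 ≠ u ∈ Ḣ¹(ℝ^{dN})`; to be used for `N ≥ 2`
and `d N ≥ 3`. It takes values in `[0, ∞]`. -/
def kappa (d N : ℕ) : ℝ≥0∞ :=
  ⨅ (u : Config d N → ℂ) (g : Fin N → Fin d → Config d N → ℂ)
    (_ : IsHomSobolevWithGradient u g) (_ : ¬ u =ᵐ[volume] 0) (_ : IsAntisymmetric u),
    kineticEnergy g / interactionEnergy u

end ManyParticleHardy

end

/-! The bound comes from an explicit trial state: a free Fermi gas of `N` particles in a smoothed
unit square. The one-particle functions are plane waves with momenta `2πk`, `k` in the integer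
lattice, times a cutoff supported in `[0, 1 + η]²`. The squares of the integer translates of the
cutoff sum to 1, so the localized waves are exactly orthonormal (`integral_wave_mul_conj`). The
trial state is their Slater determinant, and both of its energies carry the same factor `N!`.

Kinetic energy: take the `k` in a disc of area about `N`. Then `∑ |k|²` is about `N² / (2π)`, so the
kinetic energy per `N!` is `2π N²` to leading order; localization costs only `O(N)` for fixed `η`
(`kineticEnergy_slater`, `exists_lattice_points`).

Interaction: it may be lowered to `|x - y|⁻²` restricted to `|x - y| ≥ δ`. The energy is half of a
direct term minus an exchange term. The exchange term is at most `δ⁻² ∫ |γ|² = δ⁻² N`, with `γ` the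
one-particle density matrix. The direct term is at least `N² (1 - 3η)² 2π ln (η / δ)`, because
`|x|⁻²` has a logarithmically divergent integral in the plane. With `δ = N^(-1/2)` the exchange term
is `O(N²)`, while the direct term is at least `(1 - 3η)² π N² ln N` to leading order
(`le_interactionEnergy_slater`, `le_integral_cutoff_mul_truncInteraction`).

The quotient times `ln N` thus tends to `2π / ((π / 2) (1 - 3η)²) = 4 / (1 - 3η)²`, and `η` is
arbitrarily small. -/

namespace ManyParticleHardy

open scoped ComplexConjugate

/-! ### Energies of Slater determinants: direct and exchange terms. -/

section Slater

variable {E : Type*} {N : ℕ}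

/-- The antisymmetrized product `∑_σ sgn σ ∏ᵢ F i (σ i) (X i)`; for `F` independent of its first
argument it is an unnormalized Slater determinant. -/
noncomputable def slater (F : Fin N → Fin N → E → ℂ) (X : Fin N → E) : ℂ :=
  ∑ σ : Equiv.Perm (Fin N), ((Equiv.Perm.sign σ : ℤ) : ℂ) * ∏ i, F i (σ i) (X i)

lemma slater_comp_perm (f : Fin N → E → ℂ) (σ : Equiv.Perm (Fin N)) (X : Fin N → E) :
    slater (fun _ => f) X
      = ((Equiv.Perm.sign σ : ℤ) : ℂ) * slater (fun _ => f) (fun n => X (σ n)) := by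
  have h (Y : Fin N → E) : slater (fun _ => f) Y = (Matrix.of fun k i => f k (Y i)).det := by
    simp [slater, Matrix.det_apply, Units.smul_def]
  have h2 := Matrix.det_permute' σ (Matrix.of fun k i => f k (X i))
  have h3 : slater (fun _ => f) (fun n => X (σ n))
      = ((Equiv.Perm.sign σ : ℤ) : ℂ) * slater (fun _ => f) X := by
    rw [h, h, ← h2]; rfl
  rw [h3, ← mul_assoc]
  rcases Int.units_eq_one_or (Equiv.Perm.sign σ) with h | h <;> simp [h]

lemma norm_sq_slater (F : Fin N → Fin N → E → ℂ) (X : Fin N → E) :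
    ((‖slater F X‖ ^ 2 : ℝ) : ℂ) = ∑ σ : Equiv.Perm (Fin N), ∑ τ : Equiv.Perm (Fin N),
      (((Equiv.Perm.sign σ : ℤ) : ℂ) * ((Equiv.Perm.sign τ : ℤ) : ℂ)) *
        ∏ i, (F i (σ i) (X i) * conj (F i (τ i) (X i))) := by
  rw [Complex.ofReal_pow, ← Complex.mul_conj', slater, map_sum, Finset.sum_mul_sum]
  refine Finset.sum_congr rfl fun σ _ => Finset.sum_congr rfl fun τ _ => ?_
  rw [map_mul, map_prod, map_intCast, Finset.prod_mul_distrib]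
  ring

lemma perm_eq_of_eq_off_point {σ τ : Equiv.Perm (Fin N)} {n : Fin N}
    (h : ∀ i, i ≠ n → σ i = τ i) : σ = τ := by
  ext1 i
  by_cases hi : i = n
  · subst hi
    by_contra hne
    have h1 : τ.symm (σ i) ≠ i := fun h2 => hne ((Equiv.symm_apply_eq _).1 h2)
    have h2 := h _ h1
    simp at h2
    exact h1 h2
  · exact h i hi

/-- Orthonormality in all slots but two leaves exactly these pairs of permutations in a two-body
integral; `perm_eq_of_eq_off_point` does the same for one-body integrals. -/
lemma perm_eq_or_of_eq_off_pair {σ τ : Equiv.Perm (Fin N)} {n m : Fin N}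
    (h : ∀ i, i ≠ n → i ≠ m → σ i = τ i) : τ = σ ∨ τ = σ * Equiv.swap n m := by
  by_cases hn : τ n = σ n
  · left
    refine perm_eq_of_eq_off_point (n := m) fun i hi => ?_
    by_cases hin : i = n
    · rw [hin, hn]
    · exact (h i hin hi).symm
  · right
    have key : τ n = σ m := by
      by_contra hne
      have h1 : σ.symm (τ n) ≠ n := fun h2 => hn ((Equiv.symm_apply_eq _).1 h2)
      have h2 : σ.symm (τ n) ≠ m := fun h2 => hne (by rw [← h2]; simp)
      have h3 := h _ h1 h2
      simp at h3
      exact h1 h3.symm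
    refine perm_eq_of_eq_off_point (n := m) fun i hi => ?_
    by_cases hin : i = n
    · simp [hin, key]
    · simp [Equiv.swap_apply_of_ne_of_ne hin hi, h i hin hi]

variable [MeasureSpace E]

lemma integrable_mul_conj {f g : E → ℂ} (hf : MemLp f 2 volume) (hg : MemLp g 2 volume) :
    Integrable (fun x => f x * conj (g x)) :=
  hf.integrable_mul hg.star

variable [SigmaFinite (volume : Measure E)]

/-- Fubini after splitting off the two interacting coordinates; every other coordinate contributes a
one-particle integral. Writing the second index as `n.succAbove m` encodes that it differs from `n`.
-/
lemma integral_pi_pair {M : ℕ} (h : Fin (M + 2) → E → ℂ) (w : E × E → ℂ)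
    (n : Fin (M + 2)) (m : Fin (M + 1)) :
    ∫ X : Fin (M + 2) → E, (∏ i, h i (X i)) * w (X n, X (n.succAbove m))
      = (∏ j, ∫ x, h (n.succAbove (m.succAbove j)) x) *
        ∫ p : E × E, h n p.1 * h (n.succAbove m) p.2 * w p := by
  have e1 := volume_preserving_piFinSuccAbove (fun _ : Fin (M + 2) => E) n
  have e2 := (MeasurePreserving.id (volume : Measure E)).prod
    (volume_preserving_piFinSuccAbove (fun _ : Fin (M + 1) => E) m)
  have e3 := (volume_preserving_prodAssoc (α₁ := E) (β₁ := E) (γ₁ := Fin M → E)).symm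
  have e := e3.comp (e2.comp e1)
  rw [← integral_fintype_prod_volume_eq_prod (fun j => h (n.succAbove (m.succAbove j))),
    mul_comm, ← integral_prod_mul]
  let e' : (Fin (M + 2) → E) ≃ᵐ (E × E) × (Fin M → E) :=
    ((MeasurableEquiv.piFinSuccAbove (fun _ : Fin (M + 2) => E) n).trans
      ((MeasurableEquiv.refl E).prodCongr
        (MeasurableEquiv.piFinSuccAbove (fun _ : Fin (M + 1) => E) m))).trans
      MeasurableEquiv.prodAssoc.symm
  have he' : MeasurePreserving e' volume volume := e
  rw [show (volume : Measure (E × E)).prod (volume : Measure (Fin M → E)) = volume from rfl,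
    ← he'.integral_comp']
  refine integral_congr_ae (.of_forall fun X => ?_)
  have h1 : e' X = ((X n, X (n.succAbove m)), fun j => X (n.succAbove (m.succAbove j))) := rfl
  simp only [h1]
  rw [Fin.prod_univ_succAbove _ n, Fin.prod_univ_succAbove _ m]
  ring

variable {f : Fin N → E → ℂ}

lemma integrable_norm_sq_slater_mul {F : Fin N → Fin N → E → ℂ}
    (hF : ∀ i k, MemLp (F i k) 2 volume) {w : (Fin N → E) → ℝ} (hw : Measurable w) {B : ℝ}
    (hB : ∀ X, |w X| ≤ B) : Integrable (fun X => ‖slater F X‖ ^ 2 * w X) := by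
  have : Integrable (fun X => ((‖slater F X‖ ^ 2 : ℝ) : ℂ) * (w X : ℂ)) := by
    refine Integrable.mul_bdd (c := B) ?_ (by fun_prop) (.of_forall fun X => by simpa using hB X)
    simp_rw [norm_sq_slater]
    refine integrable_finsetSum _ fun σ _ => integrable_finsetSum _ fun τ _ =>
      Integrable.const_mul ?_ _
    exact Integrable.fintype_prod (f := fun i x => F i (σ i) x * conj (F i (τ i) x))
      fun i => integrable_mul_conj (hF i _) (hF i _)
  simpa [← Complex.ofReal_pow] using this.re

/-- Used with `G` a partial derivative of the orbitals. Orthonormality in the slots other than `n`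
already forces `σ = τ`, so no orthogonality of `G` is required. -/
lemma integral_norm_sq_slater_single
    (hf : ∀ k, MemLp (f k) 2 volume)
    (ho : ∀ k l, ∫ x, f k x * conj (f l x) = if k = l then 1 else 0)
    {G : Fin N → E → ℂ} (hG : ∀ k, MemLp (G k) 2 volume) (n : Fin N) :
    ∫ X, ‖slater (fun i => if i = n then G else f) X‖ ^ 2
      = ∑ σ : Equiv.Perm (Fin N), ∫ x, ‖G (σ n) x‖ ^ 2 := by
  have hF : ∀ i k, MemLp ((if i = n then G else f) k) 2 volume := by
    intro i k; split_ifs <;> simp [hG, hf]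
  have : ((∫ X, ‖slater (fun i => if i = n then G else f) X‖ ^ 2 : ℝ) : ℂ)
      = ((∑ σ : Equiv.Perm (Fin N), ∫ x, ‖G (σ n) x‖ ^ 2 : ℝ) : ℂ) := by
    rw [← integral_complex_ofReal]
    simp_rw [norm_sq_slater]
    have hint (σ τ : Equiv.Perm (Fin N)) : Integrable (fun X : Fin N → E =>
        ∏ i, ((if i = n then G else f) (σ i) (X i) *
          conj ((if i = n then G else f) (τ i) (X i)))) :=
      Integrable.fintype_prod
        (f := fun i x => (if i = n then G else f) (σ i) x * conj ((if i = n then G else f) (τ i) x))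
        fun i => integrable_mul_conj (hF i _) (hF i _)
    rw [integral_finsetSum _ fun σ _ => integrable_finsetSum _ fun τ _ => (hint σ τ).const_mul _]
    push_cast
    refine Finset.sum_congr rfl fun σ _ => ?_
    rw [integral_finsetSum _ fun τ _ => (hint σ τ).const_mul _]
    have hval (τ : Equiv.Perm (Fin N)) : ∫ X : Fin N → E,
        ∏ i, ((if i = n then G else f) (σ i) (X i) * conj ((if i = n then G else f) (τ i) (X i)))
        = ∏ i, ∫ x, (if i = n then G else f) (σ i) x * conj ((if i = n then G else f) (τ i) x) :=
      integral_fintype_prod_volume_eq_prod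
        (fun i x => (if i = n then G else f) (σ i) x * conj ((if i = n then G else f) (τ i) x))
    simp_rw [integral_const_mul, hval]
    rw [Finset.sum_eq_single σ]
    · rw [Fintype.prod_eq_single n fun i hi => by simp [hi, ho], ← integral_complex_ofReal]
      rcases Int.units_eq_one_or (Equiv.Perm.sign σ) with h | h <;>
        simp [h, Complex.mul_conj']
    · intro τ _ hτ
      have : ∃ i, i ≠ n ∧ σ i ≠ τ i := by
        by_contra! hcon
        exact hτ (perm_eq_of_eq_off_point hcon).symm
      obtain ⟨i, hi, hst⟩ := this
      rw [Finset.prod_eq_zero (Finset.mem_univ i) (by simp [hi, ho, hst]), mul_zero]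
    · simp
  exact_mod_cast this

lemma sum_integral_norm_sq_slater_single
    (hf : ∀ k, MemLp (f k) 2 volume)
    (ho : ∀ k l, ∫ x, f k x * conj (f l x) = if k = l then 1 else 0)
    {G : Fin N → E → ℂ} (hG : ∀ k, MemLp (G k) 2 volume) :
    ∑ n, ∫ X, ‖slater (fun i => if i = n then G else f) X‖ ^ 2
      = N.factorial * ∑ k, ∫ x, ‖G k x‖ ^ 2 := by
  simp_rw [integral_norm_sq_slater_single hf ho hG]
  rw [Finset.sum_comm]
  have (σ : Equiv.Perm (Fin N)) : ∑ n, ∫ x, ‖G (σ n) x‖ ^ 2 = ∑ k, ∫ x, ‖G k x‖ ^ 2 :=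
    Equiv.sum_comp σ fun k => ∫ x, ‖G k x‖ ^ 2
  simp [this, Fintype.card_perm]

/-- For fixed `σ` only `τ = σ` and `τ = σ * swap n m` survive. Their signs are opposite, which gives
direct minus exchange. -/
lemma integral_norm_sq_slater_pair
    (hf : ∀ k, MemLp (f k) 2 volume)
    (ho : ∀ k l, ∫ x, f k x * conj (f l x) = if k = l then 1 else 0)
    {w : E × E → ℝ} (hw : Measurable w) {B : ℝ} (hB : ∀ p, |w p| ≤ B)
    {n m : Fin N} (hnm : n ≠ m) :
    ((∫ X, ‖slater (fun _ => f) X‖ ^ 2 * w (X n, X m) : ℝ) : ℂ)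
      = ∑ σ : Equiv.Perm (Fin N),
        ((∫ p : E × E, (f (σ n) p.1 * conj (f (σ n) p.1)) * (f (σ m) p.2 * conj (f (σ m) p.2)) * w p)
        - ∫ p : E × E,
          (f (σ n) p.1 * conj (f (σ m) p.1)) * (f (σ m) p.2 * conj (f (σ n) p.2)) * w p) := by
  obtain ⟨M, rfl⟩ : ∃ M, N = M + 2 := by
    obtain ⟨a, ha⟩ := n
    obtain ⟨b, hb⟩ := m
    refine ⟨N - 2, ?_⟩
    simp only [ne_eq, Fin.mk.injEq] at hnm
    omega
  obtain ⟨m', rfl⟩ := Fin.exists_succAbove_eq hnm.symm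
  rw [← integral_complex_ofReal]
  push_cast
  have h0 (X : Fin (M + 2) → E) := norm_sq_slater (fun _ => f) X
  push_cast at h0
  simp_rw [h0, Finset.sum_mul, mul_assoc]
  have hint (σ τ : Equiv.Perm (Fin (M + 2))) : Integrable (fun X : Fin (M + 2) → E =>
      (∏ i, (f (σ i) (X i) * conj (f (τ i) (X i)))) * (w (X n, X (n.succAbove m')) : ℂ)) := by
    have hwm : Measurable fun X : Fin (M + 2) → E => w (X n, X (n.succAbove m')) := by fun_prop
    refine Integrable.mul_bdd (c := B) ?_ (Complex.measurable_ofReal.comp hwm).aestronglyMeasurable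
      (.of_forall fun X => by simpa using hB _)
    exact Integrable.fintype_prod (f := fun i x => f (σ i) x * conj (f (τ i) x))
      fun i => integrable_mul_conj (hf _) (hf _)
  rw [integral_finsetSum _ fun σ _ => integrable_finsetSum _ fun τ _ =>
    ((hint σ τ).const_mul _).const_mul _]
  refine Finset.sum_congr rfl fun σ _ => ?_
  rw [integral_finsetSum _ fun τ _ => ((hint σ τ).const_mul _).const_mul _]
  have hval (τ : Equiv.Perm (Fin (M + 2))) :=
    integral_pi_pair (fun i x => f (σ i) x * conj (f (τ i) x)) (fun p => (w p : ℂ)) n m'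
  simp_rw [integral_const_mul, hval]
  have hsgn : ((Equiv.Perm.sign σ : ℤ) : ℂ) * ((Equiv.Perm.sign σ : ℤ) : ℂ) = 1 := by
    rcases Int.units_eq_one_or (Equiv.Perm.sign σ) with h | h <;> simp [h]
  rw [Finset.sum_eq_add σ (σ * Equiv.swap n (n.succAbove m'))]
  · rw [Equiv.Perm.sign_mul, Equiv.Perm.sign_swap hnm]
    have hsw (j : Fin M) : Equiv.swap n (n.succAbove m') (n.succAbove (m'.succAbove j))
        = n.succAbove (m'.succAbove j) :=
      Equiv.swap_apply_of_ne_of_ne (Fin.succAbove_ne _ _)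
        (fun h => Fin.succAbove_ne _ _ (Fin.succAbove_right_injective h))
    simp only [Equiv.Perm.coe_mul, Function.comp_apply, hsw, Equiv.swap_apply_left,
      Equiv.swap_apply_right, ho, if_true, Finset.prod_const_one, one_mul]
    push_cast
    rw [mul_neg_one, neg_mul, mul_neg, ← mul_assoc, ← mul_assoc, hsgn]
    simp only [mul_assoc, one_mul]
    ring
  · intro h
    have h1 : σ n = σ (n.succAbove m') := by
      conv_lhs => rw [h]
      simp
    exact hnm (σ.injective h1)
  · intro τ _ hτ
    have : ∃ j, σ (n.succAbove (m'.succAbove j)) ≠ τ (n.succAbove (m'.succAbove j)) := by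
      by_contra! hcon
      rcases perm_eq_or_of_eq_off_pair (σ := σ) (τ := τ) (n := n) (m := n.succAbove m') (by
        intro i hi hi'
        obtain ⟨i', rfl⟩ := Fin.exists_succAbove_eq hi
        obtain ⟨j, rfl⟩ := Fin.exists_succAbove_eq (x := i') (y := m') (by rintro rfl; exact hi' rfl)
        exact hcon j) with h | h
      · exact hτ.1 h
      · exact hτ.2 h
    obtain ⟨j, hj⟩ := this
    rw [Finset.prod_eq_zero (Finset.mem_univ j) (by simp [ho, hj])]
    simp
  · simp
  · simp

lemma sum_Ioi_of_symm (g : Fin N → Fin N → ℝ) (hg : ∀ n m, g n m = g m n) :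
    ∑ n, ∑ m ∈ Finset.Ioi n, g n m = (∑ n, ∑ m, if n ≠ m then g n m else 0) / 2 := by
  have h1 (n : Fin N) : ∑ m, (if n ≠ m then g n m else 0)
      = ∑ m, (if n < m then g n m else 0) + ∑ m, (if m < n then g n m else 0) := by
    rw [← Finset.sum_add_distrib]
    refine Finset.sum_congr rfl fun m _ => ?_
    rcases lt_trichotomy n m with h | h | h
    · simp [h, h.ne, h.not_gt]
    · simp [h]
    · simp [h, h.ne', h.not_gt]
  have h2 : ∑ n, ∑ m, (if m < n then g n m else 0) = ∑ n, ∑ m, (if n < m then g n m else 0) := by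
    rw [Finset.sum_comm]
    exact Finset.sum_congr rfl fun n _ => Finset.sum_congr rfl fun m _ => by rw [hg]
  have h3 (n : Fin N) : ∑ m ∈ Finset.Ioi n, g n m = ∑ m, (if n < m then g n m else 0) := by
    rw [← Finset.sum_filter]
    congr 1
    ext; simp
  simp_rw [h1, h3]
  rw [Finset.sum_add_distrib, h2]
  ring

/-- Direct term minus a crude bound for the exchange term. -/
lemma le_sum_integral_norm_sq_slater_pair
    (hf : ∀ k, MemLp (f k) 2 volume)
    (ho : ∀ k l, ∫ x, f k x * conj (f l x) = if k = l then 1 else 0)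
    {w : E × E → ℝ} (hw : Measurable w) {B : ℝ} (hB : ∀ p, |w p| ≤ B)
    (hws : ∀ x y, w (x, y) = w (y, x)) :
    N.factorial / 2 * ((∑ k, ∑ l, ∫ p : E × E, ‖f k p.1‖ ^ 2 * ‖f l p.2‖ ^ 2 * w p) - B * N)
      ≤ ∑ n, ∑ m ∈ Finset.Ioi n, ∫ X, ‖slater (fun _ => f) X‖ ^ 2 * w (X n, X m) := by
  set D : Fin N → Fin N → ℂ := fun k l =>
    ∫ p : E × E, (f k p.1 * conj (f k p.1)) * (f l p.2 * conj (f l p.2)) * w p with hD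
  set Y : Fin N → Fin N → ℂ := fun k l =>
    ∫ p : E × E, (f k p.1 * conj (f l p.1)) * (f l p.2 * conj (f k p.2)) * w p with hY
  have hpair (k l k' l' : Fin N) : Integrable (fun p : E × E =>
      (f k p.1 * conj (f l p.1)) * (f k' p.2 * conj (f l' p.2))) :=
    (integrable_mul_conj (hf k) (hf l)).mul_prod (integrable_mul_conj (hf k') (hf l'))
  have hpairw (k l k' l' : Fin N) : Integrable (fun p : E × E =>
      (f k p.1 * conj (f l p.1)) * (f k' p.2 * conj (f l' p.2)) * (w p : ℂ)) :=
    (hpair k l k' l').mul_bdd (c := B) (by fun_prop) (.of_forall fun X => by simpa using hB _)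
  -- Direct and exchange terms cancel on the diagonal, so the sums over pairs may include `n = m`.
  have hdiag (k : Fin N) : D k k - Y k k = 0 := by simp [hD, hY]
  -- The kernel of the projection onto the span of the orbitals. The exchange sum equals `∫ |γ|² w`,
  -- and `∫ |γ|² = N` is the squared Hilbert–Schmidt norm of this projection.
  let γ : E × E → ℂ := fun p => ∑ k, f k p.1 * conj (f k p.2)
  have hγ (p : E × E) : ((‖γ p‖ ^ 2 : ℝ) : ℂ)
      = ∑ k, ∑ l, (f k p.1 * conj (f l p.1)) * (f l p.2 * conj (f k p.2)) := by
    rw [Complex.ofReal_pow, ← Complex.mul_conj', map_sum, Finset.sum_mul_sum]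
    refine Finset.sum_congr rfl fun σ _ => Finset.sum_congr rfl fun τ _ => ?_
    rw [map_mul, Complex.conj_conj]
    ring
  have hγint : ((∫ p, ‖γ p‖ ^ 2 : ℝ) : ℂ) = (N : ℝ) := by
    rw [← integral_complex_ofReal]
    simp_rw [hγ]
    rw [integral_finsetSum _ fun k _ => integrable_finsetSum _ fun l _ => hpair _ _ _ _]
    have (k : Fin N) : ∫ p : E × E, ∑ l, (f k p.1 * conj (f l p.1)) * (f l p.2 * conj (f k p.2))
        = 1 := by
      rw [integral_finsetSum _ fun l _ => hpair _ _ _ _]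
      have h (l : Fin N) : ∫ p : E × E, (f k p.1 * conj (f l p.1)) * (f l p.2 * conj (f k p.2))
          = if k = l then 1 else 0 := by
        rw [show (volume : Measure (E × E)) = volume.prod volume from rfl,
          integral_prod_mul (fun x => f k x * conj (f l x)) (fun x => f l x * conj (f k x)), ho, ho]
        by_cases h : k = l <;> simp [h]
      simp [h]
    simp [this]
  have hγint' : ∫ p, ‖γ p‖ ^ 2 = N := by exact_mod_cast hγint
  have hγI : Integrable (fun p => ‖γ p‖ ^ 2) := by
    have : Integrable (fun p => ((‖γ p‖ ^ 2 : ℝ) : ℂ)) := by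
      simp_rw [hγ]
      exact integrable_finsetSum _ fun k _ => integrable_finsetSum _ fun l _ => hpair _ _ _ _
    simpa [← Complex.ofReal_pow] using this.re
  have hYsum : ∑ k, ∑ l, Y k l = ((∫ p, ‖γ p‖ ^ 2 * w p : ℝ) : ℂ) := by
    rw [← integral_complex_ofReal]
    push_cast
    simp_rw [← Complex.ofReal_pow, hγ, Finset.sum_mul]
    rw [integral_finsetSum _ fun k _ => integrable_finsetSum _ fun l _ => hpairw _ _ _ _]
    refine Finset.sum_congr rfl fun k _ => ?_
    rw [integral_finsetSum _ fun l _ => hpairw _ _ _ _]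
  have hYle : ∫ p, ‖γ p‖ ^ 2 * w p ≤ B * N := by
    rw [← hγint', ← integral_const_mul]
    refine integral_mono (hγI.mul_bdd (c := B) (by fun_prop)
      (.of_forall fun X => by simpa using hB _)) (hγI.const_mul _) fun p => ?_
    have := (le_abs_self _).trans (hB p)
    have h2 : 0 ≤ ‖γ p‖ ^ 2 := by positivity
    simp only
    nlinarith
  have hDr (k l : Fin N) : D k l
      = ((∫ p : E × E, ‖f k p.1‖ ^ 2 * ‖f l p.2‖ ^ 2 * w p : ℝ) : ℂ) := by
    rw [← integral_complex_ofReal, hD]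
    simp [Complex.mul_conj']
  rw [sum_Ioi_of_symm (fun n m => ∫ X, ‖slater (fun _ => f) X‖ ^ 2 * w (X n, X m))
    fun n m => by simp_rw [hws (_ : E)]]
  have key : ((∑ n, ∑ m, if n ≠ m then ∫ X, ‖slater (fun _ => f) X‖ ^ 2 * w (X n, X m) else 0 : ℝ)
      : ℂ) = ((N.factorial * ((∑ k, ∑ l, ∫ p : E × E, ‖f k p.1‖ ^ 2 * ‖f l p.2‖ ^ 2 * w p)
        - ∫ p, ‖γ p‖ ^ 2 * w p) : ℝ) : ℂ) := by
    have h1 (n m : Fin N) : (((if n ≠ m then ∫ X, ‖slater (fun _ => f) X‖ ^ 2 * w (X n, X m) else 0)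
        : ℝ) : ℂ) = ∑ σ : Equiv.Perm (Fin N), (D (σ n) (σ m) - Y (σ n) (σ m)) := by
      by_cases h : n = m
      · simp [h, hdiag]
      · rw [if_pos h, integral_norm_sq_slater_pair hf ho hw hB h]
    have h2 (σ : Equiv.Perm (Fin N)) : ∑ n, ∑ m, (D (σ n) (σ m) - Y (σ n) (σ m))
        = ∑ k, ∑ l, (D k l - Y k l) := by
      rw [← Equiv.sum_comp σ (fun k => ∑ l, (D k l - Y k l))]
      exact Finset.sum_congr rfl fun n _ => Equiv.sum_comp σ (fun l => D (σ n) l - Y (σ n) l)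
    rw [Complex.ofReal_sum]
    simp_rw [Complex.ofReal_sum, h1]
    simp_rw [Finset.sum_comm (s := Finset.univ) (t := (Finset.univ : Finset (Equiv.Perm (Fin N)))),
      h2, Finset.sum_sub_distrib, hYsum, hDr]
    simp [Fintype.card_perm, mul_sub]
  have key' := Complex.ofReal_injective key
  rw [key']
  have hp : (0 : ℝ) < N.factorial := by positivity
  nlinarith

end Slater

/-! ### One-dimensional localized plane waves. -/

section Cutoff

/-- A smooth cutoff, supported in `[0, 1 + η]` and equal to `1` on `[η, 1]`, such that
`∑ⱼ cutoff η (t + j) ^ 2 = 1`. -/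
noncomputable def cutoff (η t : ℝ) : ℝ :=
  Real.sin (Real.pi / 2 * Real.smoothTransition (t / η)) *
    Real.sin (Real.pi / 2 * Real.smoothTransition ((1 + η - t) / η))

lemma smoothTransition_one_sub (x : ℝ) :
    Real.smoothTransition (1 - x) = 1 - Real.smoothTransition x := by
  have h := Real.smoothTransition.pos_denom x
  rw [Real.smoothTransition, Real.smoothTransition, sub_sub_cancel, add_comm, eq_sub_iff_add_eq,
    ← add_div, add_comm, div_self h.ne']

lemma contDiff_cutoff (η : ℝ) : ContDiff ℝ ∞ (cutoff η) := by
  have h : ContDiff ℝ ∞ Real.smoothTransition := Real.smoothTransition.contDiff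
  unfold cutoff
  fun_prop

variable {η : ℝ}

lemma cutoff_of_nonpos (hη : 0 < η) {t : ℝ} (ht : t ≤ 0) : cutoff η t = 0 := by
  rw [cutoff, Real.smoothTransition.zero_of_nonpos (div_nonpos_of_nonpos_of_nonneg ht hη.le)]
  simp

lemma cutoff_of_ge (hη : 0 < η) {t : ℝ} (ht : 1 + η ≤ t) : cutoff η t = 0 := by
  rw [cutoff, Real.smoothTransition.zero_of_nonpos (x := (1 + η - t) / η)
    (div_nonpos_of_nonpos_of_nonneg (by linarith) hη.le)]
  simp

lemma cutoff_of_le_one (hη : 0 < η) {t : ℝ} (ht : t ≤ 1) :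
    cutoff η t = Real.sin (Real.pi / 2 * Real.smoothTransition (t / η)) := by
  rw [cutoff, Real.smoothTransition.one_of_one_le (x := (1 + η - t) / η)
    ((one_le_div hη).2 (by linarith))]
  simp

lemma cutoff_of_ge_self (hη : 0 < η) {t : ℝ} (ht : η ≤ t) :
    cutoff η t = Real.sin (Real.pi / 2 * Real.smoothTransition ((1 + η - t) / η)) := by
  rw [cutoff, Real.smoothTransition.one_of_one_le ((one_le_div hη).2 ht)]
  simp

lemma cutoff_eq_one (hη : 0 < η) {t : ℝ} (h1 : η ≤ t) (h2 : t ≤ 1) : cutoff η t = 1 := by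
  rw [cutoff_of_ge_self hη h1, Real.smoothTransition.one_of_one_le ((one_le_div hη).2 (by linarith))]
  simp

/-- By the symmetry `smoothTransition_one_sub` the two angles add up to `π / 2`, so this is `sin² +
cos² = 1`. -/
lemma cutoff_sq_add_sq (hη : 0 < η) (hη1 : η < 1) {t : ℝ} (h1 : 0 ≤ t) (h2 : t ≤ 1) :
    cutoff η t ^ 2 + cutoff η (t + 1) ^ 2 = 1 := by
  rw [cutoff_of_le_one hη h2, cutoff_of_ge_self hη (by linarith),
    show (1 + η - (t + 1)) / η = 1 - t / η by field_simp; ring, smoothTransition_one_sub,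
    mul_sub, mul_one, Real.sin_pi_div_two_sub, Real.sin_sq_add_cos_sq]

lemma hasCompactSupport_cutoff (hη : 0 < η) : HasCompactSupport (cutoff η) := by
  refine HasCompactSupport.intro (isCompact_Icc (a := 0) (b := 1 + η)) fun t ht => ?_
  by_cases h : t ≤ 0
  · exact cutoff_of_nonpos hη h
  · refine cutoff_of_ge hη ?_
    by_contra! h2
    exact ht ⟨(not_le.1 h).le, h2.le⟩

/-- The localized plane wave `t ↦ exp (2πimt) * cutoff η t`. -/
noncomputable def mode (η : ℝ) (m : ℤ) (t : ℝ) : ℂ :=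
  Complex.exp ((2 * Real.pi * m : ℝ) * Complex.I * t) * cutoff η t

lemma contDiff_mode (η : ℝ) (m : ℤ) : ContDiff ℝ ∞ (mode η m) := by
  have h := contDiff_cutoff η
  have h1 : ContDiff ℝ ∞ (fun t : ℝ => (t : ℂ)) := Complex.ofRealCLM.contDiff
  have h2 : ContDiff ℝ ∞ (fun t : ℝ => (cutoff η t : ℂ)) := Complex.ofRealCLM.contDiff.comp h
  unfold mode
  fun_prop

lemma norm_sq_mode (m : ℤ) (t : ℝ) : ‖mode η m t‖ ^ 2 = cutoff η t ^ 2 := by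
  rw [mode, norm_mul, show ((2 * Real.pi * m : ℝ) : ℂ) * Complex.I * t
    = ((2 * Real.pi * m * t : ℝ) : ℂ) * Complex.I by push_cast; ring,
    Complex.norm_exp_ofReal_mul_I, one_mul, Complex.norm_real, Real.norm_eq_abs, sq_abs]

/-- The cutoff is real, so the momentum part and the cutoff derivative are orthogonal in `ℂ` up to a
common phase and there is no cross term. -/
lemma norm_sq_deriv_mode (m : ℤ) (t : ℝ) :
    ‖deriv (mode η m) t‖ ^ 2
      = 4 * Real.pi ^ 2 * m ^ 2 * cutoff η t ^ 2 + deriv (cutoff η) t ^ 2 := by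
  have h1 : HasDerivAt (fun t : ℝ => (cutoff η t : ℂ)) ((deriv (cutoff η) t : ℝ) : ℂ) t :=
    (((contDiff_cutoff η).differentiable (by simp)) t).hasDerivAt.ofReal_comp
  have h2 : HasDerivAt (fun t : ℝ => Complex.exp ((2 * Real.pi * m : ℝ) * Complex.I * t))
      (Complex.exp ((2 * Real.pi * m : ℝ) * Complex.I * t) *
        ((2 * Real.pi * m : ℝ) * Complex.I * 1)) t :=
    (Complex.ofRealCLM.hasDerivAt.const_mul _).cexp
  have h3 : deriv (mode η m) t = Complex.exp ((2 * Real.pi * m * t : ℝ) * Complex.I) *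
      ((deriv (cutoff η) t : ℝ) + (2 * Real.pi * m * cutoff η t : ℝ) * Complex.I) := by
    have h4 : HasDerivAt (mode η m) _ t := h2.mul h1
    rw [h4.deriv]
    push_cast
    rw [show (2 : ℂ) * Real.pi * m * Complex.I * t = 2 * Real.pi * m * t * Complex.I by ring]
    ring
  rw [h3, norm_mul, Complex.norm_exp_ofReal_mul_I, one_mul, Complex.sq_norm,
    Complex.normSq_add_mul_I]
  ring

lemma integral_exp_two_pi_int (m : ℤ) :
    ∫ t in (0 : ℝ)..1, Complex.exp ((2 * Real.pi * m : ℝ) * Complex.I * t)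
      = if m = 0 then 1 else 0 := by
  split_ifs with h
  · simp [h]
  · rw [integral_exp_mul_complex (by simp [h])]
    have : Complex.exp (((2 * Real.pi * m : ℝ) : ℂ) * Complex.I * (1 : ℝ)) = 1 := by
      rw [Complex.exp_eq_one_iff]
      exact ⟨m, by push_cast; ring⟩
    rw [this]
    simp

/-- The exponential has period 1, so the integral folds onto `[0, 1]`; there the squared cutoffs sum
to 1, leaving the orthogonality of characters on the circle. -/
lemma integral_mode_mul_conj (hη : 0 < η) (hη1 : η < 1) (m l : ℤ) :
    ∫ t, mode η m t * conj (mode η l t) = if m = l then 1 else 0 := by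
  set e : ℝ → ℂ := fun t => Complex.exp ((2 * Real.pi * (m - l : ℤ) : ℝ) * Complex.I * t) with he
  have h1 (t : ℝ) : mode η m t * conj (mode η l t) = e t * (cutoff η t ^ 2 : ℝ) := by
    simp only [mode, he, map_mul, ← Complex.exp_conj, Complex.conj_ofReal, Complex.conj_I]
    rw [show ((2 * Real.pi * (m - l : ℤ) : ℝ) : ℂ) * Complex.I * t
      = (2 * Real.pi * m : ℝ) * Complex.I * t + (2 * Real.pi * l : ℝ) * -Complex.I * t by
        push_cast; ring, Complex.exp_add]
    push_cast
    ring
  simp_rw [h1]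
  have hc : Continuous (cutoff η) := (contDiff_cutoff η).continuous
  have hec : Continuous e := by fun_prop
  have hcont : Continuous fun t => e t * (cutoff η t ^ 2 : ℝ) := by fun_prop
  have hcont' : Continuous fun t => e (t + 1) * (cutoff η (t + 1) ^ 2 : ℝ) := by fun_prop
  have hper (t : ℝ) : e (t + 1) = e t := by
    simp only [he]
    rw [Complex.exp_eq_exp_iff_exists_int]
    exact ⟨m - l, by push_cast; ring⟩
  have hsupp : Function.support (fun t => e t * (cutoff η t ^ 2 : ℝ)) ⊆ Set.Ioc 0 2 := by
    intro t ht
    by_contra hcon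
    apply ht
    have : cutoff η t = 0 := by
      by_cases h : t ≤ 0
      · exact cutoff_of_nonpos hη h
      · refine cutoff_of_ge hη ?_
        by_contra! h2
        exact hcon ⟨not_le.1 h, by linarith⟩
    simp [this]
  rw [← intervalIntegral.integral_eq_integral_of_support_subset hsupp,
    ← intervalIntegral.integral_add_adjacent_intervals (b := 1)
      (hcont.intervalIntegrable _ _) (hcont.intervalIntegrable _ _)]
  have h2 : ∫ t in (1 : ℝ)..2, e t * (cutoff η t ^ 2 : ℝ)
      = ∫ t in (0 : ℝ)..1, e (t + 1) * (cutoff η (t + 1) ^ 2 : ℝ) := by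
    rw [intervalIntegral.integral_comp_add_right (fun t => e t * (cutoff η t ^ 2 : ℝ))]
    norm_num
  rw [h2, ← intervalIntegral.integral_add (hcont.intervalIntegrable _ _)
    (hcont'.intervalIntegrable _ _)]
  have h3 : ∫ t in (0 : ℝ)..1, (e t * (cutoff η t ^ 2 : ℝ) +
      e (t + 1) * (cutoff η (t + 1) ^ 2 : ℝ)) = ∫ t in (0 : ℝ)..1, e t := by
    refine intervalIntegral.integral_congr fun t ht => ?_
    rw [Set.uIcc_of_le zero_le_one] at ht
    rw [hper, ← mul_add, ← Complex.ofReal_add, cutoff_sq_add_sq hη hη1 ht.1 ht.2]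
    simp
  rw [h3, he, integral_exp_two_pi_int]
  simp [sub_eq_zero]

lemma integral_cutoff_sq (hη : 0 < η) (hη1 : η < 1) : ∫ t, cutoff η t ^ 2 = 1 := by
  have h := integral_mode_mul_conj hη hη1 0 0
  have h2 (t : ℝ) : mode η 0 t * conj (mode η 0 t) = ((cutoff η t ^ 2 : ℝ) : ℂ) := by
    simp [mode, sq]
  simp_rw [h2, integral_complex_ofReal, if_true] at h
  exact_mod_cast h

lemma integral_norm_sq_deriv_mode (hη : 0 < η) (hη1 : η < 1) (m : ℤ) :
    ∫ t, ‖deriv (mode η m) t‖ ^ 2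
      = 4 * Real.pi ^ 2 * m ^ 2 + ∫ t, deriv (cutoff η) t ^ 2 := by
  have hc := contDiff_cutoff η
  have hd : Continuous (deriv (cutoff η)) := hc.continuous_deriv (by simp)
  have hs := hasCompactSupport_cutoff hη
  simp_rw [norm_sq_deriv_mode]
  rw [integral_add, integral_const_mul, integral_cutoff_sq hη hη1, mul_one]
  · refine Integrable.const_mul ?_ _
    refine (hc.continuous.pow 2).integrable_of_hasCompactSupport ?_
    exact hs.mono fun t ht => by contrapose! ht; simp at ht; simp [ht]
  · refine (hd.pow 2).integrable_of_hasCompactSupport ?_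
    exact hs.deriv.mono fun t ht => by contrapose! ht; simp at ht; simp [ht]

end Cutoff

/-! ### Localized plane waves in several dimensions. -/

section Wave

variable {d : ℕ} {η : ℝ}

lemma integral_euclidean_prod (h : Fin d → ℝ → ℂ) :
    ∫ x : EuclideanSpace ℝ (Fin d), ∏ i, h i (x i) = ∏ i, ∫ t, h i t := by
  rw [← integral_fintype_prod_volume_eq_prod]
  exact (PiLp.volume_preserving_ofLp (Fin d)).integral_comp
    (MeasurableEquiv.toLp 2 (Fin d → ℝ)).symm.measurableEmbedding
    (fun y : Fin d → ℝ => ∏ i, h i (y i))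

/-- The localized plane wave with momentum `2πk` on `ℝ^d`. -/
noncomputable def wave (η : ℝ) (k : Fin d → ℤ) (x : EuclideanSpace ℝ (Fin d)) : ℂ :=
  ∏ i, mode η (k i) (x i)

lemma contDiff_wave (η : ℝ) (k : Fin d → ℤ) : ContDiff ℝ ∞ (wave η k) := by
  unfold wave
  refine contDiff_prod fun i _ => (contDiff_mode η (k i)).comp ?_
  exact (EuclideanSpace.proj (𝕜 := ℝ) i).contDiff

lemma hasCompactSupport_wave (hη : 0 < η) (k : Fin d → ℤ) : HasCompactSupport (wave η k) := by
  have hK : IsCompact (Set.univ.pi fun _ : Fin d => Set.Icc (0 : ℝ) (1 + η)) :=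
    isCompact_univ_pi fun _ => isCompact_Icc
  refine HasCompactSupport.intro
    (hK.image (PiLp.continuous_toLp 2 (fun _ : Fin d => ℝ))) fun x hx => ?_
  by_contra hne
  apply hx
  refine ⟨x.ofLp, fun i _ => ?_, rfl⟩
  have hi : mode η (k i) (x i) ≠ 0 := (Finset.prod_ne_zero_iff.1 hne) i (Finset.mem_univ i)
  have hc : cutoff η (x i) ≠ 0 := fun h => hi (by simp [mode, h])
  constructor
  · by_contra! h
    exact hc (cutoff_of_nonpos hη h.le)
  · by_contra! h
    exact hc (cutoff_of_ge hη h.le)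

lemma norm_sq_wave (k : Fin d → ℤ) (x : EuclideanSpace ℝ (Fin d)) :
    ‖wave η k x‖ ^ 2 = ∏ i, cutoff η (x i) ^ 2 := by
  simp_rw [wave, norm_prod, ← Finset.prod_pow, norm_sq_mode]

lemma integral_wave_mul_conj (hη : 0 < η) (hη1 : η < 1) (k l : Fin d → ℤ) :
    ∫ x, wave η k x * conj (wave η l x) = if k = l then 1 else 0 := by
  simp_rw [wave, map_prod, ← Finset.prod_mul_distrib]
  rw [integral_euclidean_prod fun i t => mode η (k i) t * conj (mode η (l i) t)]
  simp_rw [integral_mode_mul_conj hη hη1]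
  split_ifs with h
  · simp [h]
  · obtain ⟨i, hi⟩ := Function.ne_iff.1 h
    exact Finset.prod_eq_zero (Finset.mem_univ i) (by simp [hi])

lemma fderiv_wave (k : Fin d → ℤ) (x : EuclideanSpace ℝ (Fin d)) (j : Fin d) :
    fderiv ℝ (wave η k) x (EuclideanSpace.single j 1)
      = ∏ i, (if i = j then deriv (mode η (k i)) else mode η (k i)) (x i) := by
  have h (i : Fin d) : HasFDerivAt (fun x : EuclideanSpace ℝ (Fin d) => mode η (k i) (x i))
      ((ContinuousLinearMap.toSpanSingleton ℝ (deriv (mode η (k i)) (x i))).comp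
        (EuclideanSpace.proj (𝕜 := ℝ) i)) x := by
    have h1 := (((contDiff_mode η (k i)).differentiable (by simp)) (x i)).hasDerivAt.hasFDerivAt
    exact h1.comp x (EuclideanSpace.proj (𝕜 := ℝ) i).hasFDerivAt
  have h2 := HasFDerivAt.finsetProd (u := Finset.univ) (fun i _ => h i)
  rw [show wave η k = fun x => ∏ i, mode η (k i) (x i) from rfl, h2.fderiv,
    sum_apply, Finset.sum_eq_single j]
  · have he : ∏ i ∈ Finset.univ.erase j,
        (if i = j then deriv (mode η (k i)) else mode η (k i)) (x i)
        = ∏ i ∈ Finset.univ.erase j, mode η (k i) (x i) :=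
      Finset.prod_congr rfl fun i hi => by rw [if_neg (Finset.ne_of_mem_erase hi)]
    rw [← Finset.mul_prod_erase Finset.univ _ (Finset.mem_univ j), if_pos rfl, mul_comm, he]
    simp
  · intro i _ hi
    simp [hi]
  · simp

lemma integral_norm_sq_fderiv_wave (hη : 0 < η) (hη1 : η < 1) (k : Fin d → ℤ) (j : Fin d) :
    ∫ x, ‖fderiv ℝ (wave η k) x (EuclideanSpace.single j 1)‖ ^ 2
      = 4 * Real.pi ^ 2 * (k j) ^ 2 + ∫ t, deriv (cutoff η) t ^ 2 := by
  apply Complex.ofReal_injective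
  rw [← integral_complex_ofReal, ← integral_norm_sq_deriv_mode hη hη1]
  have h (x : EuclideanSpace ℝ (Fin d)) :
      ((‖fderiv ℝ (wave η k) x (EuclideanSpace.single j 1)‖ ^ 2 : ℝ) : ℂ)
      = ∏ i, (fun t => ((‖(if i = j then deriv (mode η (k i)) else mode η (k i)) t‖ ^ 2 : ℝ) : ℂ))
        (x i) := by
    rw [fderiv_wave, norm_prod, ← Finset.prod_pow]
    push_cast
    rfl
  rw [integral_congr_ae (.of_forall h), integral_euclidean_prod fun i t =>
    ((‖(if i = j then deriv (mode η (k i)) else mode η (k i)) t‖ ^ 2 : ℝ) : ℂ), Fintype.prod_eq_single j]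
  · rw [integral_complex_ofReal, if_pos rfl]
  · intro i hi
    rw [integral_complex_ofReal, if_neg hi]
    simp_rw [norm_sq_mode, integral_cutoff_sq hη hη1]
    simp

end Wave

/-! ### Smoothness, support and derivatives of Slater determinants. -/

section SlaterDerivative

variable {d N : ℕ}

lemma contDiff_slater {f : Fin N → EuclideanSpace ℝ (Fin d) → ℂ}
    (hf : ∀ k, ContDiff ℝ ∞ (f k)) : ContDiff ℝ ∞ (slater fun _ => f) := by
  unfold slater
  refine ContDiff.sum fun σ _ => contDiff_const.mul (contDiff_prod fun i _ => (hf _).comp ?_)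
  exact contDiff_apply ℝ _ i

lemma hasCompactSupport_slater {f : Fin N → EuclideanSpace ℝ (Fin d) → ℂ}
    (hf : ∀ k, HasCompactSupport (f k)) : HasCompactSupport (slater fun _ => f) := by
  have hK : IsCompact (Set.univ.pi fun _ : Fin N => ⋃ k, tsupport (f k)) :=
    isCompact_univ_pi fun _ => isCompact_iUnion fun k => hf k
  refine HasCompactSupport.intro hK fun X hX => ?_
  refine Finset.sum_eq_zero fun σ _ => ?_
  rw [Set.mem_univ_pi] at hX
  push Not at hX
  obtain ⟨i, hi⟩ := hX
  have : f (σ i) (X i) = 0 := by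
    by_contra h
    exact hi (Set.mem_iUnion.2 ⟨σ i, subset_tsupport _ h⟩)
  rw [Finset.prod_eq_zero (Finset.mem_univ i) this, mul_zero]

lemma partialDeriv_slater {f : Fin N → EuclideanSpace ℝ (Fin d) → ℂ}
    (hf : ∀ k, Differentiable ℝ (f k)) (n : Fin N) (j : Fin d) (X : Config d N) :
    partialDeriv (slater fun _ => f) n j X
      = slater (fun i => if i = n then fun k x => fderiv ℝ (f k) x (EuclideanSpace.single j 1)
          else f) X := by
  have h (k i : Fin N) : HasFDerivAt (fun X : Config d N => f k (X i))
      ((fderiv ℝ (f k) (X i)).comp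
        (ContinuousLinearMap.proj (R := ℝ) (φ := fun _ : Fin N => EuclideanSpace ℝ (Fin d)) i)) X :=
    (hf k (X i)).hasFDerivAt.comp X
      (ContinuousLinearMap.proj (R := ℝ) (φ := fun _ : Fin N => EuclideanSpace ℝ (Fin d))
        i).hasFDerivAt
  have h2 (σ : Equiv.Perm (Fin N)) := (HasFDerivAt.finsetProd (u := Finset.univ)
    (fun i _ => h (σ i) i)).const_mul ((Equiv.Perm.sign σ : ℤ) : ℂ)
  have h3 := HasFDerivAt.fun_sum (u := Finset.univ) (fun σ _ => h2 σ)
  rw [partialDeriv, show (slater fun _ => f) = fun X : Config d N => ∑ σ : Equiv.Perm (Fin N),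
    ((Equiv.Perm.sign σ : ℤ) : ℂ) * ∏ i, f (σ i) (X i) from rfl, h3.fderiv,
    sum_apply, slater]
  refine Finset.sum_congr rfl fun σ _ => ?_
  rw [smul_apply, sum_apply, smul_eq_mul,
    Finset.sum_eq_single n]
  · have he : ∏ i ∈ Finset.univ.erase n, (if i = n then
        fun k x => fderiv ℝ (f k) x (EuclideanSpace.single j 1) else f) (σ i) (X i)
        = ∏ i ∈ Finset.univ.erase n, f (σ i) (X i) :=
      Finset.prod_congr rfl fun i hi => by rw [if_neg (Finset.ne_of_mem_erase hi)]
    congr 1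
    rw [← Finset.mul_prod_erase Finset.univ (fun i => (if i = n then
      fun k x => fderiv ℝ (f k) x (EuclideanSpace.single j 1) else f) (σ i) (X i))
      (Finset.mem_univ n), if_pos rfl, mul_comm, he]
    simp [dir]
  · intro i _ hi
    simp [dir, hi]
  · simp

end SlaterDerivative

/-! ### Counting lattice points in discs of the plane. -/

section Plane

lemma measurableSet_box {d : ℕ} (a b : Fin d → ℝ) :
    MeasurableSet {x : EuclideanSpace ℝ (Fin d) | ∀ i, x i ∈ Set.Ico (a i) (b i)} := by
  have : {x : EuclideanSpace ℝ (Fin d) | ∀ i, x i ∈ Set.Ico (a i) (b i)}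
      = ⋂ i, (fun x : EuclideanSpace ℝ (Fin d) => x i) ⁻¹' Set.Ico (a i) (b i) := by
    ext; simp
  rw [this]
  exact MeasurableSet.iInter fun i => measurableSet_Ico.preimage (by fun_prop)

lemma volume_box {d : ℕ} (a b : Fin d → ℝ) :
    volume {x : EuclideanSpace ℝ (Fin d) | ∀ i, x i ∈ Set.Ico (a i) (b i)}
      = ∏ i, ENNReal.ofReal (b i - a i) := by
  rw [← Real.volume_pi_Ico, ← (PiLp.volume_preserving_ofLp (Fin d)).measure_preimage
    (MeasurableSet.univ_pi fun _ => measurableSet_Ico).nullMeasurableSet]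
  congr 1
  ext x
  simp [Set.mem_pi]

lemma integral_fun_norm_plane (φ : ℝ → ℝ) :
    ∫ x : EuclideanSpace ℝ (Fin 2), φ ‖x‖ = 2 * Real.pi * ∫ r in Set.Ioi (0 : ℝ), r * φ r := by
  have h : volume.real (Metric.ball (0 : EuclideanSpace ℝ (Fin 2)) 1) = Real.pi := by
    rw [measureReal_def, EuclideanSpace.volume_ball_fin_two]
    simp [Real.pi_pos.le]
  rw [integral_fun_norm_addHaar, h]
  simp [mul_assoc]

/-- The unit square with lower left corner `k`. -/
def cell (k : Fin 2 → ℤ) : Set (EuclideanSpace ℝ (Fin 2)) :=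
  {x | ∀ i, x i ∈ Set.Ico (k i : ℝ) (k i + 1)}

/-- The lattice point `k` as a vector of the plane. -/
def latticeVec (k : Fin 2 → ℤ) : EuclideanSpace ℝ (Fin 2) := WithLp.toLp 2 fun i => (k i : ℝ)

lemma norm_sq_latticeVec (k : Fin 2 → ℤ) : ‖latticeVec k‖ ^ 2 = (k 0 : ℝ) ^ 2 + (k 1 : ℝ) ^ 2 := by
  simp [EuclideanSpace.norm_sq_eq, latticeVec]

lemma norm_sub_latticeVec_le {k : Fin 2 → ℤ} {x : EuclideanSpace ℝ (Fin 2)} (hx : x ∈ cell k) :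
    ‖x - latticeVec k‖ ≤ 2 := by
  have h : ‖x - latticeVec k‖ ^ 2 ≤ 2 ^ 2 := by
    rw [EuclideanSpace.norm_sq_eq, Fin.sum_univ_two]
    have h0 := hx 0
    have h1 := hx 1
    simp only [latticeVec, PiLp.sub_apply, Real.norm_eq_abs, sq_abs]
    have h0' := h0.1
    have h0'' := h0.2
    have h1' := h1.1
    have h1'' := h1.2
    nlinarith
  exact (sq_le_sq₀ (norm_nonneg _) (by norm_num)).1 h

lemma volume_cell (k : Fin 2 → ℤ) : volume (cell k) = 1 := by
  rw [cell, volume_box]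
  simp

lemma cell_disjoint {k l : Fin 2 → ℤ} (h : k ≠ l) : Disjoint (cell k) (cell l) := by
  rw [Set.disjoint_left]
  intro x hk hl
  apply h
  ext i
  rw [← Int.floor_eq_iff.2 (hk i), ← Int.floor_eq_iff.2 (hl i)]

lemma finite_latticeVec_norm_le (R : ℝ) : {k : Fin 2 → ℤ | ‖latticeVec k‖ ≤ R}.Finite := by
  refine (Set.Finite.pi' fun _ : Fin 2 => Set.finite_Icc (-⌈R⌉) ⌈R⌉).subset fun k hk i => ?_
  have h1 : |(k i : ℝ)| ≤ R := by
    have := PiLp.norm_apply_le (latticeVec k) i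
    simpa [latticeVec] using this.trans hk
  have h2 := abs_le.1 (h1.trans (Int.le_ceil R))
  constructor
  · exact_mod_cast h2.1
  · exact_mod_cast h2.2

/-- Unit cells with corners in the disc of radius `R` cover the ball of radius `R - 2`: a point is
within 2 of the corner of its cell. Compare areas. -/
lemma le_card_lattice_disc {R : ℝ} (hR : 2 ≤ R) :
    Real.pi * (R - 2) ^ 2 ≤ (finite_latticeVec_norm_le R).toFinset.card := by
  have hsub : Metric.ball (0 : EuclideanSpace ℝ (Fin 2)) (R - 2)
      ⊆ ⋃ k ∈ (finite_latticeVec_norm_le R).toFinset, cell k := by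
    intro x hx
    have hk : x ∈ cell fun i => ⌊x i⌋ := fun i => ⟨Int.floor_le _, Int.lt_floor_add_one _⟩
    simp only [Set.mem_iUnion]
    refine ⟨_, ?_, hk⟩
    have h1 := norm_sub_latticeVec_le hk
    have h2 := norm_le_norm_add_norm_sub x (latticeVec fun i => ⌊x i⌋)
    rw [mem_ball_zero_iff] at hx
    simp only [Set.Finite.mem_toFinset, Set.mem_ofPred_eq]
    linarith
  have h := (measure_mono (μ := volume) hsub).trans (measure_biUnion_finset_le _ _)
  simp_rw [volume_cell] at h
  rw [EuclideanSpace.volume_ball_fin_two, ← ENNReal.ofReal_pow (by linarith),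
    ← ENNReal.ofReal_mul (by positivity), Finset.sum_const, nsmul_one,
    ← ENNReal.ofReal_natCast, ENNReal.ofReal_le_ofReal_iff (by positivity)] at h
  linarith

/-- On the cell of `k` one has `‖k‖ ≤ ‖x‖ + 2` and `‖x‖ ≤ R + 2`. The cells are disjoint with area
1, so the sum is at most `∫ (‖x‖ + 2)²` over the disc of radius `R + 2`, evaluated in polar
coordinates. -/
lemma sum_norm_sq_lattice_disc_le {R : ℝ} (hR : 0 ≤ R) :
    ∑ k ∈ (finite_latticeVec_norm_le R).toFinset, ‖latticeVec k‖ ^ 2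
      ≤ Real.pi / 2 * (R + 4) ^ 4 := by
  set φ : ℝ → ℝ := (Set.Iic (R + 2)).indicator fun r => (r + 2) ^ 2 with hφ
  have hφ0 (r : ℝ) : 0 ≤ φ r := Set.indicator_nonneg (fun _ _ => by positivity) _
  set g : EuclideanSpace ℝ (Fin 2) → ℝ := fun x => φ ‖x‖ with hg
  have hgi : Integrable g := by
    have : g = (Metric.closedBall 0 (R + 2)).indicator fun x => (‖x‖ + 2) ^ 2 := by
      ext x
      by_cases h : ‖x‖ ≤ R + 2 <;> simp [hg, hφ, Set.indicator, h]
    rw [this, integrable_indicator_iff Metric.isClosed_closedBall.measurableSet]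
    exact (by fun_prop : Continuous fun x : EuclideanSpace ℝ (Fin 2) =>
      (‖x‖ + 2) ^ 2).continuousOn.integrableOn_compact (isCompact_closedBall _ _)
  have hmeas (k : Fin 2 → ℤ) : MeasurableSet (cell k) := measurableSet_box _ _
  have hk : ∀ k ∈ (finite_latticeVec_norm_le R).toFinset,
      ‖latticeVec k‖ ^ 2 ≤ ∫ x in cell k, g x := by
    intro k hk
    simp only [Set.Finite.mem_toFinset, Set.mem_ofPred_eq] at hk
    have h1 : ‖latticeVec k‖ ^ 2 = ∫ _ in cell k, ‖latticeVec k‖ ^ 2 := by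
      simp [measureReal_def, volume_cell]
    rw [h1]
    refine setIntegral_mono_on (integrableOn_const (by simp [volume_cell]))
      hgi.integrableOn (hmeas k) fun x hx => ?_
    have h2 := norm_sub_latticeVec_le hx
    have h3 := norm_le_norm_add_norm_sub x (latticeVec k)
    have h4 := norm_le_norm_add_norm_sub' x (latticeVec k)
    have h5 : g x = (‖x‖ + 2) ^ 2 := by
      simp only [hg, hφ]
      exact Set.indicator_of_mem (Set.mem_Iic.2 (by linarith)) _
    rw [h5]
    gcongr
    linarith
  refine (Finset.sum_le_sum hk).trans ?_
  rw [← integral_biUnion_finset _ (fun k _ => hmeas k)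
    (fun k _ l _ hkl => cell_disjoint hkl) (fun k _ => hgi.integrableOn)]
  refine (setIntegral_le_integral hgi (.of_forall fun x => hφ0 _)).trans ?_
  rw [hg, integral_fun_norm_plane]
  have h1 : ∫ r in Set.Ioi (0 : ℝ), r * φ r = ∫ r in (0 : ℝ)..(R + 2), r * (r + 2) ^ 2 := by
    rw [intervalIntegral.integral_of_le (by linarith), ← integral_indicator measurableSet_Ioi,
      ← integral_indicator measurableSet_Ioc]
    congr 1
    ext r
    by_cases h0 : 0 < r <;> by_cases h2 : r ≤ R + 2 <;> simp [hφ, Set.indicator_apply, h0, h2]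
  have h2 : ∫ r in (0 : ℝ)..(R + 2), r * (r + 2) ^ 2 ≤ ∫ r in (0 : ℝ)..(R + 2), (r + 2) ^ 3 := by
    refine intervalIntegral.integral_mono_on (by linarith)
      (Continuous.intervalIntegrable (by fun_prop) _ _)
      (Continuous.intervalIntegrable (by fun_prop) _ _) fun r hr => ?_
    have := hr.1
    rw [pow_succ' (r + 2) 2]
    gcongr
    linarith
  have h3 : ∫ r in (0 : ℝ)..(R + 2), (r + 2) ^ 3 ≤ (R + 4) ^ 4 / 4 := by
    rw [intervalIntegral.integral_comp_add_right (fun r => r ^ 3), integral_pow]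
    norm_num
    rw [show R + 2 + 2 = R + 4 by ring]
    linarith
  rw [h1]
  have h4 := h2.trans h3
  have := Real.pi_pos
  nlinarith

/-- `N` lattice points of the plane, with almost minimal sum of squares. -/
lemma exists_lattice_points (N : ℕ) : ∃ k : Fin N → Fin 2 → ℤ, Function.Injective k ∧
    ∑ i, ((k i 0 : ℝ) ^ 2 + (k i 1 : ℝ) ^ 2) ≤ Real.pi / 2 * (√(N / Real.pi) + 6) ^ 4 := by
  -- Chosen so that `π (R - 2)² = N`: the disc then holds at least `N` lattice points, and surplus
  -- ones are dropped.
  set R : ℝ := √(N / Real.pi) + 2 with hR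
  have hs : 0 ≤ √(N / Real.pi) := Real.sqrt_nonneg _
  have h1 := le_card_lattice_disc (R := R) (by linarith)
  have h2 := sum_norm_sq_lattice_disc_le (R := R) (by linarith)
  set S := (finite_latticeVec_norm_le R).toFinset with hS
  have hN : N ≤ S.card := by
    rw [hR, add_sub_cancel_right, Real.sq_sqrt (by positivity),
      mul_div_cancel₀ _ Real.pi_ne_zero] at h1
    exact_mod_cast h1
  obtain ⟨T, hTS, hT⟩ := Finset.exists_subset_card_eq hN
  let e : Fin N ≃ T := (T.equivFinOfCardEq hT).symm
  refine ⟨fun i => (e i : Fin 2 → ℤ), Subtype.val_injective.comp e.injective, ?_⟩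
  simp_rw [← norm_sq_latticeVec]
  rw [e.sum_comp (fun k : T => ‖latticeVec (k : Fin 2 → ℤ)‖ ^ 2),
    Finset.sum_coe_sort T (fun k => ‖latticeVec k‖ ^ 2)]
  refine (Finset.sum_le_sum_of_subset_of_nonneg hTS fun _ _ _ => by positivity).trans ?_
  rw [show √(N / Real.pi) + 6 = R + 4 by rw [hR]; ring]
  exact h2

end Plane

/-! ### The logarithm from the direct term. -/

section TruncatedInteraction

/-- The interaction `|x - y|⁻²`, cut off at distance `δ`. -/
noncomputable def truncInteraction (δ : ℝ)
    (p : EuclideanSpace ℝ (Fin 2) × EuclideanSpace ℝ (Fin 2)) : ℝ :=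
  if δ ≤ ‖p.1 - p.2‖ then (‖p.1 - p.2‖ ^ 2)⁻¹ else 0

lemma measurable_truncInteraction (δ : ℝ) : Measurable (truncInteraction δ) :=
  Measurable.ite (measurableSet_le (by fun_prop) (by fun_prop)) (by fun_prop) measurable_const

lemma truncInteraction_nonneg (δ : ℝ)
    (p : EuclideanSpace ℝ (Fin 2) × EuclideanSpace ℝ (Fin 2)) : 0 ≤ truncInteraction δ p := by
  unfold truncInteraction
  split_ifs <;> positivity

lemma abs_truncInteraction_le {δ : ℝ} (hδ : 0 < δ)
    (p : EuclideanSpace ℝ (Fin 2) × EuclideanSpace ℝ (Fin 2)) :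
    |truncInteraction δ p| ≤ (δ ^ 2)⁻¹ := by
  rw [abs_of_nonneg (truncInteraction_nonneg δ p)]
  unfold truncInteraction
  split_ifs with h
  · gcongr
  · positivity

lemma truncInteraction_swap (δ : ℝ) (x y : EuclideanSpace ℝ (Fin 2)) :
    truncInteraction δ (x, y) = truncInteraction δ (y, x) := by
  simp [truncInteraction, norm_sub_rev x y]

lemma integral_annulus {δ η : ℝ} (hδ : 0 < δ) (hδη : δ < η) :
    ∫ x : EuclideanSpace ℝ (Fin 2), (Set.Ico δ η).indicator (fun r => (r ^ 2)⁻¹) ‖x‖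
      = 2 * Real.pi * Real.log (η / δ) := by
  rw [integral_fun_norm_plane, ← integral_inv_of_pos hδ (hδ.trans hδη),
    intervalIntegral.integral_of_le hδη.le, ← integral_Ico_eq_integral_Ioc,
    ← integral_indicator measurableSet_Ioi, ← integral_indicator measurableSet_Ico]
  congr 2
  ext r
  by_cases h : r ∈ Set.Ico δ η
  · have hr : 0 < r := hδ.trans_le h.1
    rw [Set.indicator_of_mem (Set.mem_Ioi.2 hr), Set.indicator_of_mem h, Set.indicator_of_mem h]
    field_simp
  · rw [Set.indicator_of_notMem h]
    exact Set.indicator_apply_eq_zero.2 fun _ => by rw [Set.indicator_of_notMem h, mul_zero]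

/-- Keep only `x` in the square `[2η, 1 - η)²` and `δ ≤ |x - y| < η`. Then both points lie in `[η,
1]²`, where the cutoff is 1, so the integral factors into the area `(1 - 3η)²` and an annulus
integral. -/
lemma le_integral_cutoff_mul_truncInteraction {δ η : ℝ} (hδ : 0 < δ) (hδη : δ < η)
    (hη3 : η < 1 / 3) :
    (1 - 3 * η) ^ 2 * (2 * Real.pi * Real.log (η / δ))
      ≤ ∫ p : EuclideanSpace ℝ (Fin 2) × EuclideanSpace ℝ (Fin 2),
        (∏ i, cutoff η (p.1 i) ^ 2) * (∏ i, cutoff η (p.2 i) ^ 2) * truncInteraction δ p := by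
  have hη : 0 < η := hδ.trans hδη
  set V : EuclideanSpace ℝ (Fin 2) → ℝ :=
    fun x => (Set.Ico δ η).indicator (fun r => (r ^ 2)⁻¹) ‖x‖ with hV
  set Q : Set (EuclideanSpace ℝ (Fin 2)) := {x | ∀ i, x i ∈ Set.Ico (2 * η) (1 - η)} with hQ
  have hQm : MeasurableSet Q := measurableSet_box (fun _ => 2 * η) (fun _ => 1 - η)
  have hQv : volume.real Q = (1 - 3 * η) ^ 2 := by
    rw [measureReal_def, hQ, volume_box (fun _ => 2 * η) (fun _ => 1 - η)]
    simp only [Finset.prod_const, Finset.card_univ, Fintype.card_fin, ENNReal.toReal_pow]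
    rw [ENNReal.toReal_ofReal (by linarith)]
    ring
  have hVm : Measurable V :=
    ((by fun_prop : Measurable fun r : ℝ => (r ^ 2)⁻¹).indicator measurableSet_Ico).comp
      measurable_norm
  have hρ : Integrable fun x : EuclideanSpace ℝ (Fin 2) => ∏ i, cutoff η (x i) ^ 2 := by
    have hw := contDiff_wave η (0 : Fin 2 → ℤ)
    have hs := hasCompactSupport_wave hη (0 : Fin 2 → ℤ)
    simp_rw [← norm_sq_wave (0 : Fin 2 → ℤ)]
    refine (hw.continuous.norm.pow 2).integrable_of_hasCompactSupport ?_
    exact hs.mono fun x hx => by contrapose! hx; simp at hx; simp [hx]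
  have hbig : Integrable fun p : EuclideanSpace ℝ (Fin 2) × EuclideanSpace ℝ (Fin 2) =>
      (∏ i, cutoff η (p.1 i) ^ 2) * (∏ i, cutoff η (p.2 i) ^ 2) * truncInteraction δ p :=
    (hρ.mul_prod hρ).mul_bdd (measurable_truncInteraction δ).aestronglyMeasurable
      (.of_forall fun p => abs_truncInteraction_le hδ p)
  have hle (p : EuclideanSpace ℝ (Fin 2) × EuclideanSpace ℝ (Fin 2)) :
      Q.indicator 1 p.1 * V (p.2 - p.1)
      ≤ (∏ i, cutoff η (p.1 i) ^ 2) * (∏ i, cutoff η (p.2 i) ^ 2) * truncInteraction δ p := by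
    have h0 : 0 ≤ (∏ i, cutoff η (p.1 i) ^ 2) * (∏ i, cutoff η (p.2 i) ^ 2) *
        truncInteraction δ p :=
      mul_nonneg (by positivity) (truncInteraction_nonneg δ p)
    by_cases h1 : p.1 ∈ Q
    swap
    · simpa [h1] using h0
    by_cases h2 : ‖p.2 - p.1‖ ∈ Set.Ico δ η
    swap
    · simpa [hV, h2] using h0
    have h3 (i : Fin 2) : cutoff η (p.1 i) = 1 :=
      cutoff_eq_one hη (by linarith [(h1 i).1]) (by linarith [(h1 i).2])
    have h4 (i : Fin 2) : cutoff η (p.2 i) = 1 := by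
      have h5 : |p.2 i - p.1 i| ≤ ‖p.2 - p.1‖ := PiLp.norm_apply_le (p.2 - p.1) i
      have h6 := abs_lt.1 (h5.trans_lt h2.2)
      exact cutoff_eq_one hη (by linarith [(h1 i).1]) (by linarith [(h1 i).2])
    have h7 : truncInteraction δ p = (‖p.2 - p.1‖ ^ 2)⁻¹ := by
      rw [truncInteraction, norm_sub_rev, if_pos h2.1]
    rw [h7]
    simp [h3, h4, hV, h1, Set.indicator_of_mem h2]
  have hnn (p : EuclideanSpace ℝ (Fin 2) × EuclideanSpace ℝ (Fin 2)) :
      0 ≤ Q.indicator 1 p.1 * V (p.2 - p.1) :=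
    mul_nonneg (Set.indicator_nonneg (fun _ _ => zero_le_one) _)
      (Set.indicator_nonneg (fun _ _ => by positivity) _)
  have hsm : Integrable fun p : EuclideanSpace ℝ (Fin 2) × EuclideanSpace ℝ (Fin 2) =>
      Q.indicator (1 : EuclideanSpace ℝ (Fin 2) → ℝ) p.1 * V (p.2 - p.1) := by
    refine hbig.mono' ?_ (.of_forall fun p => ?_)
    · exact (((measurable_one.indicator hQm).comp measurable_fst).mul
        (hVm.comp (measurable_snd.sub measurable_fst))).aestronglyMeasurable
    · rw [Real.norm_of_nonneg (hnn p)]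
      exact hle p
  refine le_trans (le_of_eq ?_) (integral_mono hsm hbig hle)
  rw [show (volume : Measure (EuclideanSpace ℝ (Fin 2) × EuclideanSpace ℝ (Fin 2)))
    = volume.prod volume from rfl] at hsm ⊢
  rw [integral_prod _ hsm]
  simp_rw [integral_const_mul, integral_sub_right_eq_self V]
  rw [integral_mul_const, integral_indicator_one hQm, hQv, hV, integral_annulus hδ hδη]

end TruncatedInteraction

/-! ### Both energies of the trial state in `[0, ∞]`. -/

section TrialState

variable {d N : ℕ}

lemma enorm_sq_eq_ofReal (z : ℂ) : ‖z‖ₑ ^ 2 = ENNReal.ofReal (‖z‖ ^ 2) := by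
  rw [ENNReal.ofReal_pow (norm_nonneg z), ofReal_norm]

lemma isHomSobolevWithGradient_of_contDiff {u : Config d N → ℂ} (hu : ContDiff ℝ ∞ u)
    (hs : HasCompactSupport u) : IsHomSobolevWithGradient u (partialDeriv u) := by
  refine ⟨hu.continuous.locallyIntegrable, fun n j => ?_, fun _ => u, fun _ => ⟨hu, hs⟩, ?_, ?_⟩
  · have hc : Continuous (partialDeriv u n j) :=
      (hu.continuous_fderiv (by simp)).clm_apply continuous_const
    exact hc.memLp_of_hasCompactSupport (hs.fderiv_apply ℝ _)
  · intro K _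
    simp
  · intro n j
    simp

lemma kineticEnergy_slater {f : Fin N → EuclideanSpace ℝ (Fin d) → ℂ}
    (hf : ∀ k, ContDiff ℝ ∞ (f k)) (hs : ∀ k, HasCompactSupport (f k))
    (ho : ∀ k l, ∫ x, f k x * conj (f l x) = if k = l then 1 else 0) :
    kineticEnergy (partialDeriv (slater fun _ => f)) = ENNReal.ofReal (N.factorial *
      ∑ k, ∑ j, ∫ x, ‖fderiv ℝ (f k) x (EuclideanSpace.single j 1)‖ ^ 2) := by
  set G : Fin d → Fin N → EuclideanSpace ℝ (Fin d) → ℂ :=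
    fun j k x => fderiv ℝ (f k) x (EuclideanSpace.single j 1)
  have hf2 (k : Fin N) : MemLp (f k) 2 volume :=
    (hf k).continuous.memLp_of_hasCompactSupport (hs k)
  have hGc (j : Fin d) (k : Fin N) : Continuous (G j k) :=
    ((hf k).continuous_fderiv (by simp)).clm_apply continuous_const
  have hG2 (j : Fin d) (k : Fin N) : MemLp (G j k) 2 volume :=
    (hGc j k).memLp_of_hasCompactSupport ((hs k).fderiv_apply ℝ _)
  have hu := contDiff_slater hf
  have hus := hasCompactSupport_slater hs
  have hpc (n : Fin N) (j : Fin d) : Continuous (partialDeriv (slater fun _ => f) n j) :=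
    (hu.continuous_fderiv (by simp)).clm_apply continuous_const
  have hps (n : Fin N) (j : Fin d) : HasCompactSupport (partialDeriv (slater fun _ => f) n j) :=
    hus.fderiv_apply ℝ _
  have hpi (n : Fin N) (j : Fin d) :
      Integrable fun X => ‖partialDeriv (slater fun _ => f) n j X‖ ^ 2 := by
    refine ((hpc n j).norm.pow 2).integrable_of_hasCompactSupport ?_
    exact (hps n j).mono fun x hx => by contrapose! hx; simp at hx; simp [hx]
  have h1 (n : Fin N) : ∫⁻ X, ∑ j, ‖partialDeriv (slater fun _ => f) n j X‖ₑ ^ 2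
      = ENNReal.ofReal (∑ j, ∫ X, ‖partialDeriv (slater fun _ => f) n j X‖ ^ 2) := by
    rw [lintegral_finsetSum _ fun j _ => ((hpc n j).enorm.measurable.pow_const 2),
      ENNReal.ofReal_sum_of_nonneg fun j _ => integral_nonneg fun X => by positivity]
    refine Finset.sum_congr rfl fun j _ => ?_
    rw [ofReal_integral_eq_lintegral_ofReal (hpi n j) (.of_forall fun X => by positivity)]
    simp_rw [enorm_sq_eq_ofReal]
  rw [kineticEnergy]
  simp_rw [h1]
  rw [← ENNReal.ofReal_sum_of_nonneg fun n _ => Finset.sum_nonneg fun j _ =>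
    integral_nonneg fun X => by positivity]
  congr 1
  rw [Finset.sum_comm, Finset.sum_comm (s := Finset.univ (α := Fin N)), Finset.mul_sum]
  refine Finset.sum_congr rfl fun j _ => ?_
  rw [← sum_integral_norm_sq_slater_single hf2 ho (hG2 j)]
  refine Finset.sum_congr rfl fun n _ => ?_
  simp_rw [partialDeriv_slater (fun k => (hf k).differentiable (by simp))]
  rfl

lemma le_interactionEnergy_slater {f : Fin N → EuclideanSpace ℝ (Fin 2) → ℂ}
    (hf : ∀ k, MemLp (f k) 2 volume)
    (ho : ∀ k l, ∫ x, f k x * conj (f l x) = if k = l then 1 else 0) {δ : ℝ} (hδ : 0 < δ) :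
    ENNReal.ofReal (N.factorial / 2 * ((∑ k, ∑ l, ∫ p : EuclideanSpace ℝ (Fin 2) ×
      EuclideanSpace ℝ (Fin 2), ‖f k p.1‖ ^ 2 * ‖f l p.2‖ ^ 2 * truncInteraction δ p)
        - (δ ^ 2)⁻¹ * N)) ≤ interactionEnergy (slater fun _ => f) := by
  have hw := measurable_truncInteraction δ
  refine (ENNReal.ofReal_le_ofReal (le_sum_integral_norm_sq_slater_pair hf ho
    hw (abs_truncInteraction_le hδ) (truncInteraction_swap δ))).trans ?_
  have hnn (n m : Fin N) (X : Config 2 N) :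
      0 ≤ ‖slater (fun _ => f) X‖ ^ 2 * truncInteraction δ (X n, X m) :=
    mul_nonneg (by positivity) (truncInteraction_nonneg δ _)
  rw [ENNReal.ofReal_sum_of_nonneg fun n _ => Finset.sum_nonneg fun m _ =>
    integral_nonneg (hnn n m)]
  refine Finset.sum_le_sum fun n _ => ?_
  rw [ENNReal.ofReal_sum_of_nonneg fun m _ => integral_nonneg (hnn n m)]
  refine Finset.sum_le_sum fun m _ => ?_
  rw [ofReal_integral_eq_lintegral_ofReal (integrable_norm_sq_slater_mul
    (fun _ k => hf k) (by fun_prop) (fun X => abs_truncInteraction_le hδ _))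
    (.of_forall (hnn n m))]
  refine lintegral_mono fun X => ?_
  rw [ENNReal.ofReal_mul (by positivity), enorm_sq_eq_ofReal, ENNReal.div_eq_inv_mul, mul_comm]
  gcongr
  unfold truncInteraction
  split_ifs with h
  · have hpos : 0 < ‖X n - X m‖ := hδ.trans_le h
    rw [ENNReal.ofReal_inv_of_pos (by positivity), ENNReal.ofReal_pow hpos.le, ofReal_norm]
  · simp

end TrialState

/-! ### Choice of parameters and the limit. -/

section Bound

variable {N : ℕ}

/-- A positive lower bound for the interaction energy also certifies `u ≠ 0`. -/
lemma kappa_le_of_pos {u : Config 2 N → ℂ} (hu : ContDiff ℝ ∞ u) (hs : HasCompactSupport u)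
    (ha : IsAntisymmetric u) {T I : ℝ} (hI : 0 < I)
    (hT : kineticEnergy (partialDeriv u) ≤ ENNReal.ofReal T)
    (hI' : ENNReal.ofReal I ≤ interactionEnergy u) : kappa 2 N ≤ ENNReal.ofReal (T / I) := by
  have hne : ¬ u =ᵐ[volume] 0 := by
    intro h0
    have : interactionEnergy u = 0 := by
      refine Finset.sum_eq_zero fun n _ => Finset.sum_eq_zero fun m _ => ?_
      refine lintegral_eq_zero_of_ae_eq_zero ?_
      filter_upwards [h0] with X hX
      simp [hX]
    rw [this] at hI'
    simp at hI'
    linarith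
  rw [ENNReal.ofReal_div_of_pos hI]
  refine le_trans (b := kineticEnergy (partialDeriv u) / interactionEnergy u) ?_
    (ENNReal.div_le_div hT hI')
  rw [kappa]
  exact iInf_le_of_le u <| iInf_le_of_le (partialDeriv u) <|
    iInf_le_of_le (isHomSobolevWithGradient_of_contDiff hu hs) <| iInf_le_of_le hne <|
    iInf_le_of_le ha le_rfl

/-- Upper bound for the kinetic energy (up to the factor `N!`) of `N` localized plane waves. -/
noncomputable def kineticBound (η : ℝ) (N : ℕ) : ℝ :=
  2 * Real.pi ^ 3 * (√(N / Real.pi) + 6) ^ 4 + N * (2 * ∫ t, deriv (cutoff η) t ^ 2)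

/-- Lower bound for the interaction energy (up to the factor `N!`) of `N` localized plane waves. -/
noncomputable def interactionBound (η : ℝ) (N : ℕ) : ℝ :=
  1 / 2 * (N ^ 2 * ((1 - 3 * η) ^ 2 * (2 * Real.pi * (Real.log η + Real.log N / 2))) - N ^ 2)

lemma kappa_le_bound {η : ℝ} (hη : 0 < η) (hη3 : η < 1 / 3) (hN : 0 < N)
    (hNη : 1 / √N < η) (hpos : 0 < interactionBound η N) :
    kappa 2 N ≤ ENNReal.ofReal (kineticBound η N / interactionBound η N) := by
  obtain ⟨k, hk, hksum⟩ := exists_lattice_points N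
  have hN' : (0 : ℝ) < N := by exact_mod_cast hN
  have hη1 : η < 1 := by linarith
  set f : Fin N → EuclideanSpace ℝ (Fin 2) → ℂ := fun i => wave η (k i) with hfdef
  have hf (i : Fin N) : ContDiff ℝ ∞ (f i) := contDiff_wave η (k i)
  have hs (i : Fin N) : HasCompactSupport (f i) := hasCompactSupport_wave hη (k i)
  have hf2 (i : Fin N) : MemLp (f i) 2 volume :=
    (hf i).continuous.memLp_of_hasCompactSupport (hs i)
  have ho (i l : Fin N) : ∫ x, f i x * conj (f l x) = if i = l then 1 else 0 := by
    simp only [hfdef, integral_wave_mul_conj hη hη1, hk.eq_iff]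
  have hfac : (0 : ℝ) < N.factorial := by positivity
  rw [← mul_div_mul_left _ _ hfac.ne']
  refine kappa_le_of_pos (contDiff_slater hf) (hasCompactSupport_slater hs)
    (fun σ => .of_forall fun X => slater_comp_perm f σ X) (by positivity) ?_ ?_
  · rw [kineticEnergy_slater hf hs ho]
    refine ENNReal.ofReal_le_ofReal (mul_le_mul_of_nonneg_left ?_ hfac.le)
    simp only [hfdef, integral_norm_sq_fderiv_wave hη hη1, Fin.sum_univ_two]
    have h1 : ∑ i, (4 * Real.pi ^ 2 * (k i 0 : ℝ) ^ 2 + (∫ t, deriv (cutoff η) t ^ 2) +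
        (4 * Real.pi ^ 2 * (k i 1 : ℝ) ^ 2 + ∫ t, deriv (cutoff η) t ^ 2))
        = 4 * Real.pi ^ 2 * (∑ i, ((k i 0 : ℝ) ^ 2 + (k i 1 : ℝ) ^ 2)) +
          N * (2 * ∫ t, deriv (cutoff η) t ^ 2) := by
      rw [Finset.mul_sum, show (N : ℝ) * (2 * ∫ t, deriv (cutoff η) t ^ 2)
        = ∑ _i : Fin N, (2 * ∫ t, deriv (cutoff η) t ^ 2) by simp, ← Finset.sum_add_distrib]
      exact Finset.sum_congr rfl fun i _ => by ring
    rw [h1, kineticBound]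
    refine add_le_add_left ?_ _
    calc 4 * Real.pi ^ 2 * ∑ i, ((k i 0 : ℝ) ^ 2 + (k i 1 : ℝ) ^ 2)
        ≤ 4 * Real.pi ^ 2 * (Real.pi / 2 * (√(N / Real.pi) + 6) ^ 4) := by gcongr
      _ = _ := by ring
  -- Truncation at the mean interparticle distance: the exchange bound `δ⁻² N = N²` stays below the
  -- order `N² ln N`, while `ln (η / δ)` still grows like `ln N / 2`.
  · have hδ : 0 < 1 / √(N : ℝ) := by positivity
    refine le_trans (ENNReal.ofReal_le_ofReal ?_) (le_interactionEnergy_slater hf2 ho hδ)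
    have h1 := le_integral_cutoff_mul_truncInteraction hδ hNη hη3
    have hδ2 : ((1 / √(N : ℝ)) ^ 2)⁻¹ = (N : ℝ) := by
      rw [div_pow, Real.sq_sqrt hN'.le]
      simp
    have hlog : Real.log (η / (1 / √N)) = Real.log η + Real.log N / 2 := by
      rw [div_div_eq_mul_div, div_one, Real.log_mul hη.ne' (by positivity), Real.log_sqrt hN'.le]
    rw [hlog] at h1
    simp only [hfdef, norm_sq_wave, hδ2, Finset.sum_const, Finset.card_univ, Fintype.card_fin,
      nsmul_eq_mul]
    rw [interactionBound, ← mul_assoc, mul_one_div]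
    refine mul_le_mul_of_nonneg_left ?_ (by positivity)
    linarith [mul_le_mul_of_nonneg_left h1 (sq_nonneg (N : ℝ))]

lemma tendsto_log_natCast : Tendsto (fun N : ℕ => Real.log N) atTop atTop :=
  Real.tendsto_log_atTop.comp tendsto_natCast_atTop_atTop

lemma tendsto_kineticBound (η : ℝ) :
    Tendsto (fun N : ℕ => kineticBound η N / N ^ 2) atTop (𝓝 (2 * Real.pi)) := by
  set C : ℝ := 2 * ∫ t, deriv (cutoff η) t ^ 2 with hC
  have h0 : Tendsto (fun N : ℕ => (1 : ℝ) / N) atTop (𝓝 0) := tendsto_one_div_atTop_nhds_zero_nat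
  have h1 : Tendsto (fun N : ℕ => √(1 / (N : ℝ))) atTop (𝓝 0) := by
    rw [← Real.sqrt_zero]
    exact (Real.continuous_sqrt.tendsto 0).comp h0
  have h2 : Tendsto (fun N : ℕ => 2 * Real.pi ^ 3 * (√(1 / Real.pi) + 6 * √(1 / (N : ℝ))) ^ 4 +
      C * (1 / N)) atTop (𝓝 (2 * Real.pi ^ 3 * (√(1 / Real.pi) + 6 * 0) ^ 4 + C * 0)) :=
    (((h1.const_mul 6).const_add _).pow 4 |>.const_mul _).add (h0.const_mul C)
  have h3 : 2 * Real.pi ^ 3 * (√(1 / Real.pi) + 6 * 0) ^ 4 + C * 0 = 2 * Real.pi := by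
    rw [mul_zero, mul_zero, add_zero, add_zero, show 4 = 2 * 2 from rfl, pow_mul,
      Real.sq_sqrt (by positivity)]
    field_simp
  rw [h3] at h2
  refine h2.congr' ?_
  filter_upwards [eventually_gt_atTop 0] with N hN
  have hN' : (0 : ℝ) < N := by exact_mod_cast hN
  have h4 : √(N / Real.pi) + 6 = √N * (√(1 / Real.pi) + 6 * √(1 / (N : ℝ))) := by
    rw [div_eq_mul_one_div (N : ℝ), Real.sqrt_mul hN'.le, mul_add]
    rw [show √(N : ℝ) * (6 * √(1 / N)) = 6 * (√N * √(1 / N)) by ring, ← Real.sqrt_mul hN'.le (1 / N),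
      mul_one_div_cancel hN'.ne', Real.sqrt_one, mul_one]
  have h5 : √(N : ℝ) ^ 4 = N ^ 2 := by
    rw [show 4 = 2 * 2 from rfl, pow_mul, Real.sq_sqrt hN'.le]
  rw [kineticBound, h4, mul_pow, h5, ← hC]
  field_simp

lemma tendsto_interactionBound (η : ℝ) :
    Tendsto (fun N : ℕ => interactionBound η N / (N ^ 2 * Real.log N)) atTop
      (𝓝 (Real.pi / 2 * (1 - 3 * η) ^ 2)) := by
  have h0 : Tendsto (fun N : ℕ => (Real.log N)⁻¹) atTop (𝓝 0) :=
    tendsto_log_natCast.inv_tendsto_atTop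
  have h1 := (h0.const_mul ((1 - 3 * η) ^ 2 * Real.pi * Real.log η - 1 / 2)).add_const
    (Real.pi / 2 * (1 - 3 * η) ^ 2)
  rw [mul_zero, zero_add] at h1
  refine h1.congr' ?_
  filter_upwards [eventually_gt_atTop 0, tendsto_log_natCast.eventually_gt_atTop 0] with N hN hl
  have hN' : (0 : ℝ) < N := by exact_mod_cast hN
  rw [interactionBound]
  field_simp
  ring

lemma tendsto_log_mul_bound {η : ℝ} (hη3 : η < 1 / 3) :
    Tendsto (fun N : ℕ => Real.log N * (kineticBound η N / interactionBound η N)) atTop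
      (𝓝 (4 / (1 - 3 * η) ^ 2)) := by
  have hη : 0 < 1 - 3 * η := by linarith
  have h := (tendsto_kineticBound η).div (tendsto_interactionBound η) (by positivity)
  rw [show 2 * Real.pi / (Real.pi / 2 * (1 - 3 * η) ^ 2) = 4 / (1 - 3 * η) ^ 2 by
    field_simp; ring] at h
  refine h.congr' ?_
  filter_upwards [eventually_gt_atTop 0, tendsto_log_natCast.eventually_gt_atTop 0] with N hN hl
  have hN' : (0 : ℝ) < N := by exact_mod_cast hN
  simp only [Pi.div_apply]
  field_simp

lemma eventually_interactionBound_pos {η : ℝ} (hη3 : η < 1 / 3) :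
    ∀ᶠ N : ℕ in atTop, 0 < interactionBound η N := by
  have hη : 0 < 1 - 3 * η := by linarith
  have hlim : 0 < Real.pi / 2 * (1 - 3 * η) ^ 2 := by positivity
  filter_upwards [(tendsto_interactionBound η).eventually_const_lt hlim, eventually_gt_atTop 0,
    tendsto_log_natCast.eventually_gt_atTop 0] with N h hN hl
  have hN' : (0 : ℝ) < N := by exact_mod_cast hN
  exact (div_pos_iff_of_pos_right (by positivity)).1 h

/-- `η` is fixed before `N → ∞`, small enough that `4 / (1 - 3η)² < c`; the localization energy may
therefore depend on `η` in any way. -/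
lemma eventually_log_mul_kappa_le {c : ℝ} (hc : 4 < c) :
    ∀ᶠ N : ℕ in atTop, ENNReal.ofReal (Real.log N) * kappa 2 N ≤ ENNReal.ofReal c := by
  obtain ⟨η, hη, hη3, hηc⟩ : ∃ η : ℝ, 0 < η ∧ η < 1 / 3 ∧ 4 / (1 - 3 * η) ^ 2 < c := by
    have hcont : ContinuousAt (fun η : ℝ => 4 / (1 - 3 * η) ^ 2) 0 :=
      continuousAt_const.div (by fun_prop) (by norm_num)
    have h1 : ∀ᶠ η in 𝓝[>] (0 : ℝ), 4 / (1 - 3 * η) ^ 2 < c :=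
      (hcont.tendsto.eventually_lt_const (by norm_num [hc])).filter_mono nhdsWithin_le_nhds
    have h2 : ∀ᶠ η in 𝓝[>] (0 : ℝ), η ∈ Set.Ioo (0 : ℝ) (1 / 3) :=
      Ioo_mem_nhdsGT (by norm_num)
    obtain ⟨η, h1, h2⟩ := (h1.and h2).exists
    exact ⟨η, h2.1, h2.2, h1⟩
  have hsqrt : ∀ᶠ N : ℕ in atTop, 1 / √(N : ℝ) < η := by
    have h : Tendsto (fun N : ℕ => 1 / √(N : ℝ)) atTop (𝓝 0) := by
      simp_rw [one_div]
      exact (Real.tendsto_sqrt_atTop.comp tendsto_natCast_atTop_atTop).inv_tendsto_atTop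
    exact h.eventually_lt_const hη
  filter_upwards [(tendsto_log_mul_bound hη3).eventually_lt_const hηc, hsqrt,
    eventually_interactionBound_pos hη3, eventually_gt_atTop 0,
    tendsto_log_natCast.eventually_gt_atTop 0] with N h1 h2 h3 h4 h5
  calc ENNReal.ofReal (Real.log N) * kappa 2 N
      ≤ ENNReal.ofReal (Real.log N) *
        ENNReal.ofReal (kineticBound η N / interactionBound η N) := by
        gcongr
        exact kappa_le_bound hη hη3 h4 h2 h3
    _ = ENNReal.ofReal (Real.log N * (kineticBound η N / interactionBound η N)) :=
        (ENNReal.ofReal_mul h5.le).symm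
    _ ≤ ENNReal.ofReal c := ENNReal.ofReal_le_ofReal h1.le

end Bound

end ManyParticleHardy

theorem propositionB1 :
    Filter.limsup
      (fun N : ℕ => ENNReal.ofReal (Real.log (N : ℝ)) * ManyParticleHardy.kappa 2 N)
      Filter.atTop ≤ 4 := by
  refine ENNReal.le_of_forall_pos_le_add fun ε hε _ => ?_
  have h : (4 : ℝ) < 4 + ε := by simpa using hε
  refine (limsup_le_of_le (by isBoundedDefault)
    (ManyParticleHardy.eventually_log_mul_kappa_le h)).trans (le_of_eq ?_)
  rw [ENNReal.ofReal_add (by norm_num) ε.coe_nonneg, ENNReal.ofReal_coe_nnreal]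
  norm_num
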